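/- Let $n\ge 1$ be an integer and let $S^n\subset\mathbb{R}^{n+1}$ be the unit sphere with its round metric. For $p\in\mathbb{R}$ and $f:S^n\to\mathbb{R}$ consider the equation $$\det(\nabla^2h+hI)=f\,h^{p-1}\quad\text{on } S^n, \tag{1}$$ where $\nabla^2 h$ is the covariant Hessian and the determinant is taken in an orthonormal frame of the tangent space. A solution of (1) is a positive function $h\in C^2(S^n)$ that satisfies (1) at every point of $S^n$ (no positive definiteness of $\nabla^2h+hI$ is required). (a) If $p=-n-1$, there is a function $f>0$ on $S^n$, belonging to $C^\alpha(S^n)$ for every $\alpha\in(0,1)$, for which (1) has no solution. (b) For every $p<-n-1$ there are $\alpha\in(0,1)$ and $f\in C^\alpha(S^n)$ with $f(x)>0$ for all $x\in S^n\setminus\{\pm e_{n+1}\}$, where $\pm e_{n+1}$ are the two poles, for which (1) has no solution. -/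

import Mathlib

open scoped NNReal Manifold ContDiff

noncomputable section

/-- The ambient Euclidean space `ℝ^{n+1}`. -/
abbrev Amb (n : ℕ) : Type := EuclideanSpace ℝ (Fin (n + 1))

/-- The unit sphere `S^n ⊆ ℝ^{n+1}`. -/
abbrev Sph (n : ℕ) : Type := Metric.sphere (0 : Amb n) 1

/-- The tangent space `T_x S^n`, i.e. the orthogonal complement of `x` in `ℝ^{n+1}`, with the
induced inner product (the round metric). -/
abbrev SphTangent {n : ℕ} (x : Sph n) : Submodule ℝ (Amb n) := (ℝ ∙ (x : Amb n))ᗮ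

/-- The north pole `(0, …, 0, 1)`; the south pole is `-northPole n`. -/
def northPole (n : ℕ) : Sph n := ⟨EuclideanSpace.single (Fin.last n) 1, by simp⟩

/-- The extension `y ↦ h (y / ‖y‖)` of `h`, constant along open rays from the origin
(with a dummy value at the origin, which plays no role). -/
def radialExt {n : ℕ} (h : Sph n → ℝ) (y : Amb n) : ℝ :=
  if hy : y = 0 then 0
  else h ⟨‖y‖⁻¹ • y, by simp [norm_smul, hy]⟩

/-- The Hessian tensor `(∇²h)_x (v, w)` of a `C²` function `h` on the round sphere.
For any extension `F` of `h`, the Gauss formula gives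
`(∇²h)_x (v, w) = D²F_x (v, w) - ⟪v, w⟫ (∂F/∂x)(x)`; the extension used here has vanishing radial
derivative, so that the covariant Hessian is the restriction of `D²F_x` to `T_x S^n`. -/
def sphHessian {n : ℕ} (h : Sph n → ℝ) (x : Sph n) (v w : SphTangent x) : ℝ :=
  fderiv ℝ (fderiv ℝ (radialExt h)) (x : Amb n) (v : Amb n) (w : Amb n)

/-- The matrix `[∇²_{ij} h + h δ_{ij}]` at `x`, in the frame `e` of `T_x S^n`. -/
def sphMatrix {n : ℕ} (h : Sph n → ℝ) (x : Sph n) (e : Fin n → SphTangent x) :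
    Matrix (Fin n) (Fin n) ℝ :=
  Matrix.of (fun i j => sphHessian h x (e i) (e j)) + h x • (1 : Matrix (Fin n) (Fin n) ℝ)

/-- `h` is a (classical) solution of `det(∇²h + h I) = f h^{p-1}` on `S^n`: a positive function of
class `C²` that satisfies the equation at every point, the determinant being computed in
orthonormal frames of the tangent space (its value does not depend on the frame). -/
structure IsSolution {n : ℕ} (p : ℝ) (f h : Sph n → ℝ) : Prop where
  contMDiff : ContMDiff (𝓡 n) 𝓘(ℝ, ℝ) 2 h
  pos : ∀ x, 0 < h x
  eqn : ∀ (x : Sph n) (e : OrthonormalBasis (Fin n) ℝ (SphTangent x)),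
    (sphMatrix h x e).det = f x * h x ^ (p - 1)

end

/-! The obstruction is of Kazdan–Warner type. Extend a solution `h` to the function `H` on ℝ^{n+1} ∖
{0} that is homogeneous of degree one. At x ∈ S^n the Hessian D²H kills x and restricts to ∇²h + hI
on the tangent space, so (1) says that its cofactor matrix is f h^{p-1} x xᵀ
(`IsSolution.det_updateRow_hessMatrix`).

The Jacobian determinant of a compactly supported C¹ map has integral zero
(`integral_det_fderiv_eq_zero`). For a map built from ∇H and a radial cut-off this gives, for i ≠ j
and a radial weight, ∫ f H^{p-1} (y_i ∂_iH − y_j ∂_jH) = 0; the field y_i e_i − y_j e_j generates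
volume-preserving linear maps.

Take f = φ(x_i²), s = y_i²/|y|², q = y_j²/|y|². Integration by parts
(`IsSolution.integral_weight_mul_eq_zero`) leaves the weighted identity ∫ H^p [2s(1−s+q) φ'(s) −
(n+1+p)(s−q) φ(s)] = 0. Since H^p > 0, no solution exists if the bracket is ≤ 0 for s, q ≥ 0, s + q
≤ 1, and negative somewhere. For p = −n−1 the second term disappears and φ = 2 − s works; for p <
−n−1 a high power of 1 − s works, at the price of vanishing at the poles. -/

/-! ### Integrals of Jacobian determinants. -/

/-- det(1 + tA) is a polynomial in t of degree at most dim E whose coefficient in that degree is det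
A; Lagrange interpolation extracts it from dim E + 1 values. -/
theorem det_eq_sum_det_one_add_smul {E : Type*} [NormedAddCommGroup E] [NormedSpace ℝ E]
    [FiniteDimensional ℝ E] (v : ℕ → ℝ) (hv : Function.Injective v) (A : E →L[ℝ] E) :
    A.det = ∑ i ∈ Finset.range (Module.finrank ℝ E + 1),
      (1 + v i • A).det / ∏ j ∈ (Finset.range (Module.finrank ℝ E + 1)).erase i, (v i - v j) := by
  classical
  set m := Module.finrank ℝ E
  let b := Module.finBasis ℝ E
  let M := LinearMap.toMatrix b b (A : E →ₗ[ℝ] E)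
  let P : Polynomial ℝ :=
    ((Polynomial.X : Polynomial ℝ) • M.map Polynomial.C +
      (1 : Matrix (Fin m) (Fin m) ℝ).map Polynomial.C).det
  have hdet : ∀ t : ℝ, (1 + t • A).det = P.eval t := by
    intro t
    rw [← Polynomial.coe_evalRingHom, RingHom.map_det, ContinuousLinearMap.det,
      ← LinearMap.det_toMatrix b]
    congr 1
    have h1 : LinearMap.toMatrix b b ((1 + t • A : E →L[ℝ] E) : E →ₗ[ℝ] E) = 1 + t • M := by
      have : ((1 + t • A : E →L[ℝ] E) : E →ₗ[ℝ] E) = LinearMap.id + t • (A : E →ₗ[ℝ] E) := rfl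
      rw [this, map_add, map_smul, LinearMap.toMatrix_id]
    rw [h1]
    ext i j
    by_cases hij : i = j
    · subst hij; simp; ring
    · simp [hij]; ring
  have hlead : A.det = P.coeff m := by
    have h := Polynomial.coeff_det_X_add_C_card M 1
    rw [Fintype.card_fin] at h
    rw [h, ContinuousLinearMap.det, LinearMap.det_toMatrix]
  have hdeg : P.degree < ((Finset.range (m + 1)).card : WithBot ℕ) := by
    have h := Polynomial.natDegree_det_X_add_C_le M 1
    rw [Fintype.card_fin] at h
    rw [Finset.card_range]
    exact lt_of_le_of_lt (Polynomial.degree_le_of_natDegree_le h) (by exact_mod_cast Nat.lt_succ_self m)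
  have h := Lagrange.coeff_eq_sum (s := Finset.range (m + 1)) (v := v) hv.injOn hdeg
  rw [Finset.card_range, Nat.add_sub_cancel] at h
  rw [hlead, h]
  simp only [hdet]

/-- A perturbation of the identity with Lipschitz constant below 1 is a bijection. It fixes every
point off the support, so it must map the support onto itself. -/
theorem image_tsupport_id_add_smul {E : Type*} [NormedAddCommGroup E] [NormedSpace ℝ E]
    [CompleteSpace E] {Φ : E → E} {C : ℝ≥0} (hΦ : LipschitzWith C Φ) {t : ℝ} (ht : |t| * C < 1) :
    Function.Injective (fun y => y + t • Φ y) ∧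
      (fun y => y + t • Φ y) '' tsupport Φ = tsupport Φ := by
  set f : E → E := fun y => y + t • Φ y
  rcases subsingleton_or_nontrivial E with hE | hE
  · refine ⟨Function.injective_of_subsingleton _, ?_⟩
    rw [Subsingleton.elim f id, Set.image_id]
  have happ : ApproximatesLinearOn f ((ContinuousLinearEquiv.refl ℝ E : E ≃L[ℝ] E) : E →L[ℝ] E)
      Set.univ (‖t‖₊ * C) := by
    intro x _ y _
    have : f x - f y - ((ContinuousLinearEquiv.refl ℝ E : E ≃L[ℝ] E) : E →L[ℝ] E) (x - y)
        = t • (Φ x - Φ y) := by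
      simp only [f, ContinuousLinearEquiv.coe_refl, ContinuousLinearMap.id_apply, smul_sub]
      abel
    rw [this, norm_smul, NNReal.coe_mul, coe_nnnorm, mul_assoc]
    gcongr
    simpa [dist_eq_norm] using hΦ.dist_le_mul x y
  have hc : ‖t‖₊ * C <
      ‖((ContinuousLinearEquiv.refl ℝ E : E ≃L[ℝ] E).symm : E →L[ℝ] E)‖₊⁻¹ := by
    have h1 : ‖((ContinuousLinearEquiv.refl ℝ E : E ≃L[ℝ] E).symm : E →L[ℝ] E)‖₊ = 1 := by
      ext
      simp
    rw [h1, inv_one, ← NNReal.coe_lt_coe]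
    simpa using ht
  let e := happ.toHomeomorph f (Or.inr hc)
  have hinj : Function.Injective f := e.injective
  have hsurj : Function.Surjective f := e.surjective
  have hout : ∀ z, z ∉ tsupport Φ → f z = z := by
    intro z hz
    simp [f, image_eq_zero_of_notMem_tsupport hz]
  refine ⟨hinj, Set.Subset.antisymm ?_ ?_⟩
  · rintro _ ⟨y, hy, rfl⟩
    by_contra h
    exact h ((hinj (hout _ h)).symm ▸ hy)
  · intro z hz
    obtain ⟨y, rfl⟩ := hsurj z
    refine ⟨y, ?_, rfl⟩
    by_contra h
    rw [hout y h] at hz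
    exact h hz

open MeasureTheory in
/-- The Jacobian determinant of a compactly supported `C¹` map has vanishing integral. -/
theorem integral_det_fderiv_eq_zero {E : Type*} [NormedAddCommGroup E] [NormedSpace ℝ E]
    [FiniteDimensional ℝ E] [Nontrivial E] [MeasurableSpace E] [BorelSpace E] (μ : Measure E)
    [μ.IsAddHaarMeasure] {Φ : E → E} (hΦ : ContDiff ℝ 1 Φ) (hc : HasCompactSupport Φ) :
    ∫ y, (fderiv ℝ Φ y).det ∂μ = 0 := by
  have : CompleteSpace E := FiniteDimensional.complete ℝ E
  obtain ⟨C, hC⟩ := hΦ.lipschitzWith_of_hasCompactSupport hc one_ne_zero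
  have hdc : Continuous (fun A : E →L[ℝ] E => A.det) := ContinuousLinearMap.continuous_det
  obtain ⟨δ, hδ, hpos⟩ : ∃ δ > 0, ∀ A : E →L[ℝ] E, ‖A‖ < δ → 0 < (1 + A).det := by
    have h1 : Filter.Tendsto (fun A : E →L[ℝ] E => (1 + A).det) (nhds 0) (nhds 1) := by
      have h2 : Continuous (fun A : E →L[ℝ] E => (1 + A).det) := hdc.comp (by fun_prop)
      have h3 : (1 + (0 : E →L[ℝ] E)).det = 1 := by
        rw [add_zero, ContinuousLinearMap.det]; exact LinearMap.det_id
      have h4 := h2.tendsto 0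
      rw [h3] at h4
      exact h4
    obtain ⟨δ, hδ, h⟩ := Metric.eventually_nhds_iff.1 (h1.eventually (lt_mem_nhds one_pos))
    exact ⟨δ, hδ, fun A hA => h (by simpa using hA)⟩
  -- For 0 < t ≤ ε the bound tC < 1 makes id + tΦ bijective, and tC < δ makes its Jacobian positive.
  set ε : ℝ := min δ 1 / (C + 1)
  have hε : 0 < ε := by positivity
  have hεC : ε * C < min δ 1 := by
    rw [div_mul_eq_mul_div, div_lt_iff₀ (by positivity)]
    nlinarith [lt_min hδ one_pos]
  -- Change of variables: the integral is the volume of the image of the support, hence independent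
  -- of t.
  have hsmall : ∀ t : ℝ, 0 < t → t ≤ ε →
      ∫ y in tsupport Φ, (1 + t • fderiv ℝ Φ y).det ∂μ = μ.real (tsupport Φ) := by
    intro t ht0 ht
    have htC : t * C < min δ 1 := lt_of_le_of_lt (by gcongr) hεC
    obtain ⟨hinj, himg⟩ := image_tsupport_id_add_smul hC (t := t)
      (by rw [abs_of_pos ht0]; exact htC.trans_le (min_le_right _ _))
    have hder : ∀ y ∈ tsupport Φ, HasFDerivWithinAt (fun y => y + t • Φ y)
        (1 + t • fderiv ℝ Φ y) (tsupport Φ) y := fun y _ =>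
      ((hasFDerivAt_id y).add (((hΦ.differentiable one_ne_zero) y).hasFDerivAt.const_smul
        t)).hasFDerivWithinAt
    have h := integral_image_eq_integral_abs_det_fderiv_smul μ hc.isCompact.measurableSet hder
      hinj.injOn (fun _ => (1 : ℝ))
    rw [himg] at h
    simp only [setIntegral_const, smul_eq_mul, mul_one] at h
    rw [h]
    refine setIntegral_congr_fun hc.isCompact.measurableSet fun y _ => ?_
    refine (abs_of_pos (hpos _ ?_)).symm
    rw [norm_smul, Real.norm_of_nonneg ht0.le]
    have := norm_fderiv_le_of_lipschitz ℝ hC (x₀ := y)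
    calc t * ‖fderiv ℝ Φ y‖ ≤ t * C := by gcongr
      _ < δ := htC.trans_le (min_le_left _ _)
  let v : ℕ → ℝ := fun i => ε / (i + 1)
  have hv0 : ∀ i, 0 < v i := fun i => by positivity
  have hv1 : ∀ i, v i ≤ ε := fun i => div_le_self hε.le (by simp)
  have hvinj : Function.Injective v := by
    intro i j hij
    simp only [v] at hij
    field_simp at hij
    exact_mod_cast (add_right_cancel hij).symm
  have hcont : ∀ t : ℝ, Continuous fun y => (1 + t • fderiv ℝ Φ y).det := fun t =>
    hdc.comp (by have := hΦ.continuous_fderiv one_ne_zero; fun_prop)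
  -- Interpolating for A = 0, where det A = 0 because dim E ≥ 1, shows that the interpolation
  -- coefficients sum to zero.
  have hzero : ∑ i ∈ Finset.range (Module.finrank ℝ E + 1),
      1 / ∏ j ∈ (Finset.range (Module.finrank ℝ E + 1)).erase i, (v i - v j) = 0 := by
    have h := det_eq_sum_det_one_add_smul v hvinj (0 : E →L[ℝ] E)
    have h0 : (0 : E →L[ℝ] E).det = 0 := by
      rw [ContinuousLinearMap.det, ContinuousLinearMap.toLinearMap_zero, LinearMap.det_zero,
        zero_pow Module.finrank_pos.ne']
    have h1 : (1 : E →L[ℝ] E).det = 1 := by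
      rw [ContinuousLinearMap.det]; exact LinearMap.det_id
    simpa only [smul_zero, add_zero, h0, h1] using h.symm
  have hsupp : ∫ y, (fderiv ℝ Φ y).det ∂μ = ∫ y in tsupport Φ, (fderiv ℝ Φ y).det ∂μ := by
    refine (setIntegral_eq_integral_of_forall_compl_eq_zero fun y hy => ?_).symm
    rw [image_eq_zero_of_notMem_tsupport (fun h => hy (tsupport_fderiv_subset ℝ h)),
      ContinuousLinearMap.det, ContinuousLinearMap.toLinearMap_zero, LinearMap.det_zero,
      zero_pow Module.finrank_pos.ne']
  rw [hsupp]
  simp_rw [fun y => det_eq_sum_det_one_add_smul v hvinj (fderiv ℝ Φ y)]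
  rw [integral_finsetSum _ fun i _ =>
    ((hcont (v i)).continuousOn.integrableOn_compact hc.isCompact).div_const _]
  simp_rw [integral_div, fun i => hsmall (v i) (hv0 i) (hv1 i), div_eq_mul_one_div (μ.real _),
    ← Finset.mul_sum]
  rw [hzero, mul_zero]

/-! ### Integral identities for Hessians and divergences. -/

noncomputable section

/-- The matrix of second partial derivatives of `G` at `y`. -/
def hessMatrix {ι : Type*} [Fintype ι] [DecidableEq ι] (G : EuclideanSpace ℝ ι → ℝ)
    (y : EuclideanSpace ℝ ι) : Matrix ι ι ℝ :=
  Matrix.of fun k l => fderiv ℝ (fderiv ℝ G) y (EuclideanSpace.single l 1)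
    (EuclideanSpace.single k 1)

/-- The gradient of `c` at `y`, as a row of partial derivatives. -/
def gradRow {ι : Type*} [Fintype ι] [DecidableEq ι] (c : EuclideanSpace ℝ ι → ℝ)
    (y : EuclideanSpace ℝ ι) : ι → ℝ :=
  fun l => fderiv ℝ c y (EuclideanSpace.single l 1)

theorem det_updateRow_updateRow_smul_add {ι : Type*} [Fintype ι] [DecidableEq ι]
    (M : Matrix ι ι ℝ) (v : ι → ℝ) {i j : ι} (hij : i ≠ j) (a b : ℝ) :
    ((M.updateRow i v).updateRow j (a • M j + b • M i)).det =
      a * (M.updateRow i v).det - b * (M.updateRow j v).det := by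
  rw [Matrix.det_updateRow_add, Matrix.det_updateRow_smul, Matrix.det_updateRow_smul]
  have h1 : (M.updateRow i v).updateRow j (M j) = M.updateRow i v := by
    ext k l
    by_cases hk : k = j
    · subst hk; simp [hij.symm]
    · simp [Matrix.updateRow_apply, hk]
  have h2 : (M.updateRow i v).updateRow j (M i) =
      (M.updateRow j v).submatrix (Equiv.swap i j) id := by
    ext k l
    by_cases hk : k = j
    · subst hk; simp [Matrix.updateRow_apply, hij]
    · by_cases hk' : k = i
      · subst hk'; simp [Matrix.updateRow_apply, hij]
      · simp [Matrix.updateRow_apply, hk, hk', Equiv.swap_apply_of_ne_of_ne hk' hk]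
  rw [h1, h2, Matrix.det_permute, Equiv.Perm.sign_swap hij]
  push_cast
  ring

-- The integrand is the Jacobian determinant of the map with components ∂_kG, except that the i-th
-- is c and the j-th is ∂_iG · ∂_jG. This map is C¹ although G is only C².
open MeasureTheory in
theorem integral_cofactor_identity {ι : Type*} [Fintype ι] [DecidableEq ι]
    {G c : EuclideanSpace ℝ ι → ℝ} (hG : ContDiff ℝ 2 G) (hGc : HasCompactSupport G)
    (hc : ContDiff ℝ 1 c) (hcc : HasCompactSupport c) {i j : ι} (hij : i ≠ j) :
    ∫ y, (gradRow G y i * ((hessMatrix G y).updateRow i (gradRow c y)).det -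
      gradRow G y j * ((hessMatrix G y).updateRow j (gradRow c y)).det) = 0 := by
  have : Nonempty ι := ⟨i⟩
  have hX : ContDiff ℝ 1 (fderiv ℝ G) := hG.fderiv_right (by norm_num)
  have hXd : ∀ y, DifferentiableAt ℝ (fderiv ℝ G) y := hX.differentiable one_ne_zero
  let φ : ι → EuclideanSpace ℝ ι → ℝ := fun k y =>
    if k = j then gradRow G y i * gradRow G y j else if k = i then c y else gradRow G y k
  have hgrad : ∀ k, ContDiff ℝ 1 (fun y => gradRow G y k) := fun k =>
    hX.clm_apply contDiff_const
  have hφ : ∀ k, ContDiff ℝ 1 (φ k) := by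
    intro k
    simp only [φ]
    split_ifs
    · exact (hgrad i).mul (hgrad j)
    · exact hc
    · exact hgrad k
  let Φ : EuclideanSpace ℝ ι → EuclideanSpace ℝ ι := fun y => WithLp.toLp 2 fun k => φ k y
  have hΦ : ContDiff ℝ 1 Φ := contDiff_euclidean.2 hφ
  have hΦc : HasCompactSupport Φ := by
    refine HasCompactSupport.of_support_subset_isCompact
      (hcc.isCompact.union hGc.isCompact) fun y hy => ?_
    by_contra h
    rw [Set.mem_union, not_or] at h
    have h1 : c y = 0 := image_eq_zero_of_notMem_tsupport h.1
    have h2 : fderiv ℝ G y = 0 :=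
      image_eq_zero_of_notMem_tsupport fun h' => h.2 (tsupport_fderiv_subset ℝ h')
    apply hy
    ext k
    simp [Φ, φ, gradRow, h1, h2]
  rw [← integral_det_fderiv_eq_zero volume hΦ hΦc]
  congr 1
  ext y
  rw [← det_updateRow_updateRow_smul_add _ _ hij, ContinuousLinearMap.det,
    ← LinearMap.det_toMatrix (EuclideanSpace.basisFun ι ℝ).toBasis]
  congr 1
  have hgd : ∀ k, HasFDerivAt (fun y => gradRow G y k)
      ((fderiv ℝ (fderiv ℝ G) y).flip (EuclideanSpace.single k 1)) y := by
    intro k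
    have h := (hXd y).hasFDerivAt.clm_apply
      (hasFDerivAt_const (EuclideanSpace.single k (1 : ℝ)) y)
    refine h.congr_fderiv ?_
    ext v
    simp
  have hcomp : ∀ k v, (fderiv ℝ Φ y v) k = fderiv ℝ (φ k) y v := by
    intro k v
    have h := (EuclideanSpace.proj (𝕜 := ℝ) k).hasFDerivAt.comp y
      ((hΦ.differentiable one_ne_zero) y).hasFDerivAt
    exact (congrArg (fun L => L v) (HasFDerivAt.fderiv (f := φ k) h)).symm
  ext k l
  rw [LinearMap.toMatrix_apply]
  simp only [OrthonormalBasis.coe_toBasis, EuclideanSpace.basisFun_apply,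
    OrthonormalBasis.coe_toBasis_repr_apply, EuclideanSpace.basisFun_repr,
    ContinuousLinearMap.coe_coe, hcomp]
  by_cases hk : k = j
  · subst hk
    have : φ k = fun y => gradRow G y i * gradRow G y k := by ext; simp [φ]
    rw [this, HasFDerivAt.fderiv (f := fun y => gradRow G y i * gradRow G y k)
      ((hgd i).mul (hgd k))]
    simp [hessMatrix]
  · by_cases hk' : k = i
    · subst hk'
      have : φ k = c := by ext; simp [φ, hk]
      simp [this, Matrix.updateRow_apply, hk, gradRow]
    · have : φ k = fun y => gradRow G y k := by ext; simp [φ, hk, hk']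
      rw [this, (hgd k).fderiv]
      simp [hessMatrix, Matrix.updateRow_apply, hk, hk']

-- The integrand is ∂_k(y_k g).
open MeasureTheory in
theorem integral_gradRow_mul_coord_add {ι : Type*} [Fintype ι] [DecidableEq ι]
    {g : EuclideanSpace ℝ ι → ℝ} (hg : ContDiff ℝ 1 g) (hgc : HasCompactSupport g) (k : ι) :
    ∫ y : EuclideanSpace ℝ ι, (gradRow g y k * y k + g y) = 0 := by
  have h1 : Continuous (fderiv ℝ g) := hg.continuous_fderiv one_ne_zero
  have hgcont := hg.continuous
  have hi1 : Integrable (fun y => gradRow g y k * y k) := by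
    simp only [gradRow]
    exact Continuous.integrable_of_hasCompactSupport (by fun_prop)
      ((hgc.fderiv_apply ℝ _).mul_right)
  have hi0 : Integrable g := hgcont.integrable_of_hasCompactSupport hgc
  have hpd : ∀ y : EuclideanSpace ℝ ι,
      HasFDerivAt (fun y : EuclideanSpace ℝ ι => y k) (EuclideanSpace.proj (𝕜 := ℝ) k) y :=
    fun y => (EuclideanSpace.proj (𝕜 := ℝ) k).hasFDerivAt
  have h := integral_mul_fderiv_eq_neg_fderiv_mul_of_integrable (μ := volume)
    (f := g) (g := fun y : EuclideanSpace ℝ ι => y k) (v := EuclideanSpace.single k 1) hi1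
    (by simpa [(hpd _).fderiv] using hi0)
    (Continuous.integrable_of_hasCompactSupport (by fun_prop) hgc.mul_right)
    (fun x _ => hg.differentiable one_ne_zero x) (fun x _ => (hpd x).differentiableAt)
  simp only [(hpd _).fderiv] at h
  rw [integral_add hi1 hi0]
  simp only [gradRow]
  simp at h
  linarith

/-! ### Determinants of symmetric matrices with a kernel vector. -/

/-- Once row i is x, multiples of it can be added to the other rows, turning M into N = M + xxᵀ.
Since Nx = x, the adjugate of N maps x to det(N) x. -/
theorem Matrix.det_updateRow_of_mulVec_eq_zero {ι : Type*} [Fintype ι] [DecidableEq ι]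
    {M : Matrix ι ι ℝ} {x : ι → ℝ} (hM : M.transpose = M) (hMx : M.mulVec x = 0)
    (hx : x ⬝ᵥ x = 1) (i : ι) :
    (M.updateRow i x).det = (M + Matrix.vecMulVec x x).det * x i := by
  set N := M + Matrix.vecMulVec x x with hN
  have hNx : N.mulVec x = x := by
    rw [hN, Matrix.add_mulVec, hMx, zero_add, Matrix.vecMulVec_mulVec, hx]
    simp
  have hNt : N.transpose = N := by
    rw [hN, Matrix.transpose_add, hM, Matrix.transpose_vecMulVec]
  have h1 : (M.updateRow i x).det = (N.updateRow i x).det := by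
    refine Matrix.det_eq_of_forall_row_eq_smul_add_const (fun k => if k = i then 0 else -x k) i
      (by simp) fun k l => ?_
    by_cases hk : k = i
    · subst hk; simp
    · simp [Matrix.updateRow_apply, hk, hN, Matrix.vecMulVec_apply]
  have h2 : N.adjugate.mulVec x = N.det • x := by
    conv_lhs => rw [← hNx]
    rw [Matrix.mulVec_mulVec, Matrix.adjugate_mul, Matrix.smul_mulVec, Matrix.one_mulVec]
  rw [h1, ← Matrix.cramer_transpose_apply, hNt, Matrix.cramer_eq_adjugate_mulVec, h2]
  simp

/-- In the orthonormal basis (x, e) the matrix is block diagonal, with blocks 1 and B(e_i, e_j). -/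
theorem det_add_vecMulVec_eq_det_frame {n : ℕ} (B : Amb n →L[ℝ] Amb n →L[ℝ] ℝ) {x : Amb n}
    (hx : ‖x‖ = 1) (hBx : ∀ v, B x v = 0) {e : Fin n → Amb n} (he : Orthonormal ℝ e)
    (hxe : ∀ i, inner ℝ x (e i) = 0) :
    (Matrix.of (fun k l => B (EuclideanSpace.single k 1) (EuclideanSpace.single l 1)) +
      Matrix.vecMulVec x x).det = (Matrix.of fun i j => B (e i) (e j)).det := by
  set N : Matrix (Fin (n + 1)) (Fin (n + 1)) ℝ :=
    Matrix.of (fun k l => B (EuclideanSpace.single k 1) (EuclideanSpace.single l 1)) +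
      Matrix.vecMulVec x x with hN
  let q : Fin (n + 1) → Amb n := Fin.cons x e
  let Q : Matrix (Fin (n + 1)) (Fin (n + 1)) ℝ := Matrix.of fun a k => q a k
  have hinner : ∀ v w : Amb n, inner ℝ v w = ∑ k, v k * w k := by
    intro v w
    simp [PiLp.inner_apply, mul_comm]
  have hxx : inner ℝ x x = 1 := by rw [real_inner_self_eq_norm_sq, hx, one_pow]
  have hqq : ∀ a b, inner ℝ (q a) (q b) = if a = b then (1 : ℝ) else 0 := by
    intro a b
    refine Fin.cases ?_ (fun i => ?_) a <;> refine Fin.cases ?_ (fun j => ?_) b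
    · simp [q, hx]
    · simp [q, hxe, (Fin.succ_ne_zero j).symm]
    · simp [q, real_inner_comm, hxe]
    · simp [q, orthonormal_iff_ite.1 he]
  have hQQ : Q * Q.transpose = 1 := by
    ext a b
    rw [Matrix.mul_apply, Matrix.one_apply, ← hqq, hinner]
    rfl
  have hsingle : ∀ v : Amb n, v = ∑ k, v k • EuclideanSpace.single k (1 : ℝ) := by
    intro v
    simpa using ((EuclideanSpace.basisFun (Fin (n + 1)) ℝ).sum_repr v).symm
  have hB : ∀ v w : Amb n, B v w =
      ∑ l, (∑ k, v k * B (EuclideanSpace.single k 1) (EuclideanSpace.single l 1)) * w l := by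
    intro v w
    conv_lhs => rw [hsingle v, hsingle w]
    simp only [map_sum, map_smul, _root_.sum_apply, _root_.smul_apply,
      smul_eq_mul]
    refine Finset.sum_congr rfl fun l _ => ?_
    rw [mul_comm]
  have hQNQ : ∀ a b, (Q * N * Q.transpose) a b =
      B (q a) (q b) + inner ℝ (q a) x * inner ℝ x (q b) := by
    intro a b
    rw [hB, hinner (q a) x, hinner x (q b), Matrix.mul_apply, Finset.mul_sum,
      ← Finset.sum_add_distrib]
    refine Finset.sum_congr rfl fun l _ => ?_
    rw [Matrix.mul_apply, hN]
    simp only [Matrix.add_apply, Matrix.of_apply, Matrix.vecMulVec_apply, Matrix.transpose_apply,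
      mul_add, Finset.sum_add_distrib, Q, add_mul, Finset.sum_mul]
    congr 1
    refine Finset.sum_congr rfl fun k _ => ?_
    ring
  have hdet : N.det = (Q * N * Q.transpose).det := by
    have h := congrArg Matrix.det hQQ
    rw [Matrix.det_mul, Matrix.det_one] at h
    rw [Matrix.det_mul, Matrix.det_mul, mul_comm Q.det, mul_assoc, h, mul_one]
  rw [hdet, Matrix.det_succ_row_zero, Fin.sum_univ_succ, Finset.sum_eq_zero]
  · have hsub : (Q * N * Q.transpose).submatrix Fin.succ (Fin.succAbove 0) =
        Matrix.of fun i j => B (e i) (e j) := by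
      ext i j
      rw [Matrix.submatrix_apply, hQNQ]
      simp [q, hxe]
    rw [hsub, hQNQ]
    simp [q, hBx, hx]
  · intro j _
    rw [hQNQ]
    simp [q, hBx, hxe]

/-! ### The homogeneous extension and its Hessian. -/

/-- The extension of `h` that is homogeneous of degree one. -/
def homExt {n : ℕ} (h : Sph n → ℝ) (y : Amb n) : ℝ := ‖y‖ * radialExt h y

/-- The projection of a nonzero vector to the unit sphere. -/
def sphProj {n : ℕ} (y : Amb n) (hy : y ≠ 0) : Sph n := ⟨‖y‖⁻¹ • y, by simp [norm_smul, hy]⟩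

theorem radialExt_of_ne {n : ℕ} (h : Sph n → ℝ) {y : Amb n} (hy : y ≠ 0) :
    radialExt h y = h (sphProj y hy) := by
  rw [radialExt, dif_neg hy]; rfl

theorem Sph.coe_ne_zero {n : ℕ} (x : Sph n) : (x : Amb n) ≠ 0 := by
  intro h
  have := x.2
  simp [h] at this

theorem Sph.norm_coe {n : ℕ} (x : Sph n) : ‖(x : Amb n)‖ = 1 := by
  simp

theorem radialExt_coe {n : ℕ} (h : Sph n → ℝ) (x : Sph n) : radialExt h (x : Amb n) = h x := by
  rw [radialExt_of_ne h (Sph.coe_ne_zero x)]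
  congr 1
  ext1
  simp [sphProj, Sph.norm_coe x]

theorem radialExt_smul {n : ℕ} (h : Sph n → ℝ) {t : ℝ} (ht : 0 < t) (y : Amb n) :
    radialExt h (t • y) = radialExt h y := by
  by_cases hy : y = 0
  · simp [hy]
  · have hty : t • y ≠ 0 := smul_ne_zero ht.ne' hy
    rw [radialExt_of_ne h hy, radialExt_of_ne h hty]
    congr 1
    ext1
    simp only [sphProj, norm_smul, Real.norm_of_nonneg ht.le, smul_smul]
    congr 1
    have : ‖y‖ ≠ 0 := norm_ne_zero_iff.2 hy
    field_simp

theorem homExt_smul {n : ℕ} (h : Sph n → ℝ) {t : ℝ} (ht : 0 < t) (y : Amb n) :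
    homExt h (t • y) = t * homExt h y := by
  rw [homExt, homExt, radialExt_smul h ht, norm_smul, Real.norm_of_nonneg ht.le, mul_assoc]

theorem contDiffAt_radialExt {n : ℕ} {h : Sph n → ℝ} (hh : ContMDiff (𝓡 n) 𝓘(ℝ, ℝ) 2 h)
    {y : Amb n} (hy : y ≠ 0) : ContDiffAt ℝ 2 (radialExt h) y := by
  let U : TopologicalSpace.Opens (Amb n) := ⟨{0}ᶜ, isOpen_compl_singleton⟩
  have h1 : ContMDiff 𝓘(ℝ, Amb n) 𝓘(ℝ, Amb n) 2 (fun z : U => ‖(z : Amb n)‖⁻¹ • (z : Amb n)) := by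
    intro z
    rw [contMDiffAt_subtype_iff (f := fun z : Amb n => ‖z‖⁻¹ • z)]
    have hz : (z : Amb n) ≠ 0 := z.2
    exact (((contDiffAt_norm ℝ hz).inv (norm_ne_zero_iff.2 hz)).smul contDiffAt_id).contMDiffAt
  have hmem : ∀ z : U, ‖(z : Amb n)‖⁻¹ • (z : Amb n) ∈ Metric.sphere (0 : Amb n) 1 := by
    intro z
    have hz : (z : Amb n) ≠ 0 := z.2
    simp [norm_smul, hz]
  have : Fact (Module.finrank ℝ (Amb n) = n + 1) := ⟨by simp⟩
  have h2 := hh.comp (h1.codRestrict_sphere (n := n) hmem)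
  have h3 : ContMDiffAt 𝓘(ℝ, Amb n) 𝓘(ℝ, ℝ) 2 (fun z : U => radialExt h (z : Amb n)) ⟨y, hy⟩ := by
    refine (h2 ⟨y, hy⟩).congr_of_eventuallyEq (Filter.Eventually.of_forall fun z => ?_)
    exact radialExt_of_ne h z.2
  rw [contMDiffAt_subtype_iff] at h3
  exact h3.contDiffAt

theorem contDiffAt_homExt {n : ℕ} {h : Sph n → ℝ} (hh : ContMDiff (𝓡 n) 𝓘(ℝ, ℝ) 2 h)
    {y : Amb n} (hy : y ≠ 0) : ContDiffAt ℝ 2 (homExt h) y :=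
  (contDiffAt_norm ℝ hy).mul (contDiffAt_radialExt hh hy)

theorem homExt_pos {n : ℕ} {h : Sph n → ℝ} (hh : ∀ x, 0 < h x) {y : Amb n} (hy : y ≠ 0) :
    0 < homExt h y := by
  rw [homExt, radialExt_of_ne h hy]
  exact mul_pos (norm_pos_iff.2 hy) (hh _)

theorem fderiv_homExt_smul {n : ℕ} (h : Sph n → ℝ) {t : ℝ} (ht : 0 < t) (y : Amb n) :
    fderiv ℝ (homExt h) (t • y) = fderiv ℝ (homExt h) y := by
  have h1 : (fun y => homExt h (t • y)) = fun y => t • homExt h y := by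
    ext y; rw [homExt_smul h ht, smul_eq_mul]
  have h2 := congrFun (congrArg (fderiv ℝ) h1) y
  rw [fderiv_comp_smul] at h2
  replace h2 := h2.trans (congrFun (fderiv_const_smul_field t) y)
  exact smul_right_injective _ ht.ne' h2

theorem fderiv_fderiv_homExt_smul {n : ℕ} (h : Sph n → ℝ) {t : ℝ} (ht : 0 < t) (y : Amb n) :
    fderiv ℝ (fderiv ℝ (homExt h)) (t • y) = t⁻¹ • fderiv ℝ (fderiv ℝ (homExt h)) y := by
  have h1 : (fun y => fderiv ℝ (homExt h) (t • y)) = fun y => fderiv ℝ (homExt h) y := by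
    ext1 y; rw [fderiv_homExt_smul h ht]
  have h2 := congrFun (congrArg (fderiv ℝ) h1) y
  rw [fderiv_comp_smul] at h2
  rw [← h2, smul_smul, inv_mul_cancel₀ ht.ne', one_smul]

theorem fderiv_homExt_self {n : ℕ} {h : Sph n → ℝ} (hh : ContMDiff (𝓡 n) 𝓘(ℝ, ℝ) 2 h)
    {y : Amb n} (hy : y ≠ 0) : fderiv ℝ (homExt h) y y = homExt h y := by
  have h1 : HasDerivAt (fun t : ℝ => homExt h (t • y)) (fderiv ℝ (homExt h) y y) 1 := by
    have hd : HasFDerivAt (homExt h) (fderiv ℝ (homExt h) y) ((1 : ℝ) • y) := by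
      rw [one_smul]
      exact ((contDiffAt_homExt hh hy).differentiableAt two_ne_zero).hasFDerivAt
    have := hd.comp_hasDerivAt (1 : ℝ) ((hasDerivAt_id (1 : ℝ)).smul_const y)
    rw [one_smul] at this
    exact this
  have h2 : HasDerivAt (fun t : ℝ => homExt h (t • y)) (homExt h y) 1 := by
    have := (hasDerivAt_id (1 : ℝ)).mul_const (homExt h y)
    rw [one_mul] at this
    refine this.congr_of_eventuallyEq ?_
    filter_upwards [lt_mem_nhds (zero_lt_one' ℝ)] with t ht
    rw [homExt_smul h ht, id]
  exact h1.unique h2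

theorem fderiv_fderiv_homExt_self {n : ℕ} {h : Sph n → ℝ} (hh : ContMDiff (𝓡 n) 𝓘(ℝ, ℝ) 2 h)
    {y : Amb n} (hy : y ≠ 0) : fderiv ℝ (fderiv ℝ (homExt h)) y y = 0 := by
  have h1 : HasDerivAt (fun t : ℝ => fderiv ℝ (homExt h) (t • y))
      (fderiv ℝ (fderiv ℝ (homExt h)) y y) 1 := by
    have hd : HasFDerivAt (fderiv ℝ (homExt h)) (fderiv ℝ (fderiv ℝ (homExt h)) y)
        ((1 : ℝ) • y) := by
      rw [one_smul]
      exact (((contDiffAt_homExt hh hy).fderiv_right (m := 1) (by norm_num)).differentiableAt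
        one_ne_zero).hasFDerivAt
    have := hd.comp_hasDerivAt (1 : ℝ) ((hasDerivAt_id (1 : ℝ)).smul_const y)
    rw [one_smul] at this
    exact this
  have h2 : HasDerivAt (fun t : ℝ => fderiv ℝ (homExt h) (t • y)) 0 1 := by
    refine (hasDerivAt_const (1 : ℝ) (fderiv ℝ (homExt h) y)).congr_of_eventuallyEq ?_
    filter_upwards [lt_mem_nhds (zero_lt_one' ℝ)] with t ht
    rw [fderiv_homExt_smul h ht]
  exact h1.unique h2

/-- In the Leibniz rule for ‖y‖ · `radialExt h`, the first derivative of the norm vanishes on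
tangent vectors and its second derivative is the inner product there. -/
theorem fderiv_fderiv_homExt_tangent {n : ℕ} {h : Sph n → ℝ}
    (hh : ContMDiff (𝓡 n) 𝓘(ℝ, ℝ) 2 h) (x : Sph n) {v w : Amb n}
    (hv : inner ℝ (x : Amb n) v = 0) (hw : inner ℝ (x : Amb n) w = 0) :
    fderiv ℝ (fderiv ℝ (homExt h)) (x : Amb n) v w =
      fderiv ℝ (fderiv ℝ (radialExt h)) (x : Amb n) v w + h x * inner ℝ v w := by
  have hx0 := Sph.coe_ne_zero x
  have hnd : ∀ y : Amb n, y ≠ 0 →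
      HasFDerivAt (fun y : Amb n => ‖y‖) (‖y‖⁻¹ • innerSL ℝ y) y := by
    intro y hy
    have h1 := (hasStrictFDerivAt_norm_sq y).hasFDerivAt.sqrt
      (pow_ne_zero 2 (norm_ne_zero_iff.2 hy))
    simp only [Real.sqrt_sq (norm_nonneg _)] at h1
    refine h1.congr_fderiv ?_
    ext v
    simp
    ring
  have hR : ∀ y : Amb n, y ≠ 0 → HasFDerivAt (radialExt h) (fderiv ℝ (radialExt h) y) y :=
    fun y hy => ((contDiffAt_radialExt hh hy).differentiableAt two_ne_zero).hasFDerivAt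
  have hR2 : HasFDerivAt (fderiv ℝ (radialExt h))
      (fderiv ℝ (fderiv ℝ (radialExt h)) (x : Amb n)) (x : Amb n) :=
    (((contDiffAt_radialExt hh hx0).fderiv_right (m := 1) (by norm_num)).differentiableAt
        one_ne_zero).hasFDerivAt
  have hH2 : HasFDerivAt (fderiv ℝ (homExt h))
      (fderiv ℝ (fderiv ℝ (homExt h)) (x : Amb n)) (x : Amb n) :=
    (((contDiffAt_homExt hh hx0).fderiv_right (m := 1) (by norm_num)).differentiableAt
        one_ne_zero).hasFDerivAt
  have hform : (fun y => fderiv ℝ (homExt h) y w) =ᶠ[nhds (x : Amb n)]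
      fun y => ‖y‖ * fderiv ℝ (radialExt h) y w + radialExt h y * (‖y‖⁻¹ * inner ℝ y w) := by
    filter_upwards [isOpen_ne.mem_nhds hx0] with y hy
    have : HasFDerivAt (homExt h) _ y := (hnd y hy).mul (hR y hy)
    rw [this.fderiv]
    simp
  have h1 := (hH2.clm_apply (hasFDerivAt_const w (x : Amb n))).congr_of_eventuallyEq hform.symm
  have hin : HasFDerivAt (fun y : Amb n => inner ℝ y w) (innerSL ℝ w) (x : Amb n) := by
    have := (innerSL ℝ w).hasFDerivAt (x := (x : Amb n))
    refine this.congr_of_eventuallyEq (Filter.Eventually.of_forall fun y => ?_)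
    simp [real_inner_comm]
  have hnx : ‖(x : Amb n)‖ ≠ 0 := norm_ne_zero_iff.2 hx0
  have h2 := ((hnd _ hx0).mul (hR2.clm_apply (hasFDerivAt_const w (x : Amb n)))).add
    ((hR _ hx0).mul (((hasDerivAt_inv hnx).comp_hasFDerivAt _ (hnd _ hx0)).mul hin))
  have h3 := congrArg (fun L => L v) (h1.unique h2)
  simp [hv, hw, Sph.norm_coe x, radialExt_coe, real_inner_comm] at h3
  rw [h3, real_inner_comm, real_inner_comm (x : Amb n) w, hw]
  ring

theorem IsSolution.det_updateRow_hessMatrix {n : ℕ} {p : ℝ} {f h : Sph n → ℝ}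
    (hs : IsSolution p f h) {y : Amb n} (hy : y ≠ 0) (i : Fin (n + 1)) :
    ((hessMatrix (homExt h) y).updateRow i y).det =
      (‖y‖⁻¹) ^ n * (f (sphProj y hy) * h (sphProj y hy) ^ (p - 1)) * y i := by
  set x := sphProj y hy with hxdef
  have hr : 0 < ‖y‖ := norm_pos_iff.2 hy
  have hyx : y = ‖y‖ • (x : Amb n) := by
    simp only [hxdef, sphProj, smul_smul]
    rw [mul_inv_cancel₀ hr.ne', one_smul]
  have hsymm : ∀ v w, fderiv ℝ (fderiv ℝ (homExt h)) (x : Amb n) v w =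
      fderiv ℝ (fderiv ℝ (homExt h)) (x : Amb n) w v := fun v w =>
    ((contDiffAt_homExt hs.contMDiff (Sph.coe_ne_zero x)).isSymmSndFDerivAt (by simp)) v w
  set B := fderiv ℝ (fderiv ℝ (homExt h)) (x : Amb n) with hB
  have hBx : ∀ v, B x v = 0 := fun v => by
    rw [hB, fderiv_fderiv_homExt_self hs.contMDiff (Sph.coe_ne_zero x)]; rfl
  set M := hessMatrix (homExt h) (x : Amb n) with hM
  have hMeq : M = Matrix.of (fun k l => B (EuclideanSpace.single k 1)
      (EuclideanSpace.single l 1)) := by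
    ext k l
    rw [hM, hessMatrix, Matrix.of_apply, Matrix.of_apply, ← hB, hsymm]
  have hMt : M.transpose = M := by
    rw [hMeq]; ext k l
    rw [Matrix.transpose_apply, Matrix.of_apply, Matrix.of_apply, hsymm]
  have hMx : M.mulVec x = 0 := by
    ext k
    have h1 : ∑ l, (x : Amb n) l • EuclideanSpace.single l (1 : ℝ) = (x : Amb n) := by
      simpa using (EuclideanSpace.basisFun (Fin (n + 1)) ℝ).sum_repr (x : Amb n)
    have h2 : B (EuclideanSpace.single k 1)
        (∑ l, (x : Amb n) l • EuclideanSpace.single l (1 : ℝ)) = 0 := by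
      rw [h1, hsymm, hBx]
    rw [map_sum] at h2
    rw [hMeq, Matrix.mulVec, dotProduct, Pi.zero_apply, ← h2]
    refine Finset.sum_congr rfl fun l _ => ?_
    rw [map_smul, smul_eq_mul, Matrix.of_apply, mul_comm]
  have hxx : (x : Amb n).ofLp ⬝ᵥ (x : Amb n).ofLp = 1 := by
    have h1 := real_inner_self_eq_norm_sq (x : Amb n)
    rw [Sph.norm_coe, one_pow, PiLp.inner_apply] at h1
    simpa [dotProduct, sq] using h1
  have hfin : Module.finrank ℝ (SphTangent x) = n := by
    have : Fact (Module.finrank ℝ (Amb n) = n + 1) := ⟨by simp⟩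
    exact Submodule.finrank_orthogonal_span_singleton (Sph.coe_ne_zero x)
  let e : OrthonormalBasis (Fin n) ℝ (SphTangent x) :=
    (stdOrthonormalBasis ℝ (SphTangent x)).reindex (finCongr hfin)
  have hxe : ∀ i, inner ℝ (x : Amb n) (e i : Amb n) = 0 := fun i =>
    Submodule.mem_orthogonal_singleton_iff_inner_right.1 (e i).2
  have heo : Orthonormal ℝ fun i => (e i : Amb n) :=
    e.orthonormal.comp_linearIsometry (SphTangent x).subtypeₗᵢ
  have hdet : (M + Matrix.vecMulVec (x : Amb n) (x : Amb n)).det =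
      f x * h x ^ (p - 1) := by
    rw [hMeq, det_add_vecMulVec_eq_det_frame B (Sph.norm_coe x) hBx heo hxe, ← hs.eqn x e]
    congr 1
    ext a b
    rw [Matrix.of_apply, hB, fderiv_fderiv_homExt_tangent hs.contMDiff x (hxe a) (hxe b)]
    simp only [sphMatrix, Matrix.add_apply, Matrix.of_apply, sphHessian, Matrix.smul_apply,
      smul_eq_mul, Matrix.one_apply]
    rw [orthonormal_iff_ite.1 heo]
  -- D²H has degree −1; writing y = ‖y‖⁻¹ · ‖y‖² x lets the same factor leave all n + 1 rows.
  have hscale : (hessMatrix (homExt h) y).updateRow i y =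
      ‖y‖⁻¹ • M.updateRow i (‖y‖ ^ 2 • (x : Amb n).ofLp) := by
    have hMy : hessMatrix (homExt h) y = ‖y‖⁻¹ • M := by
      ext k l
      rw [hessMatrix, Matrix.of_apply, hyx, fderiv_fderiv_homExt_smul h hr, norm_smul,
        Sph.norm_coe, norm_norm, mul_one]
      rfl
    rw [hMy]
    ext k l
    by_cases hk : k = i
    · subst hk
      have : y l = ‖y‖ * (x : Amb n) l := congrArg (fun z : Amb n => z l) hyx
      simp only [Matrix.updateRow_self, Matrix.smul_apply, Pi.smul_apply, smul_eq_mul]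
      rw [this]
      field_simp
    · simp [Matrix.updateRow_apply, hk]
  rw [hscale, Matrix.det_smul, Matrix.det_updateRow_smul,
    Matrix.det_updateRow_of_mulVec_eq_zero hMt hMx hxx, hdet, Fintype.card_fin]
  have : y i = ‖y‖ * (x : Amb n) i := congrArg (fun z : Amb n => z i) hyx
  rw [this, pow_succ]
  field_simp

/-! ### Radial cut-offs and weights. -/

theorem Real.deriv_smoothTransition_of_le_zero {t : ℝ} (ht : t ≤ 0) :
    deriv Real.smoothTransition t = 0 := by
  refine IsLocalMin.deriv_eq_zero (Filter.Eventually.of_forall fun s => ?_)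
  rw [Real.smoothTransition.zero_of_nonpos ht]
  exact Real.smoothTransition.nonneg s

theorem Real.deriv_smoothTransition_of_one_le {t : ℝ} (ht : 1 ≤ t) :
    deriv Real.smoothTransition t = 0 := by
  refine IsLocalMax.deriv_eq_zero (Filter.Eventually.of_forall fun s => ?_)
  rw [Real.smoothTransition.one_of_one_le ht]
  exact Real.smoothTransition.le_one s

theorem Real.exists_deriv_smoothTransition_pos :
    ∃ t ∈ Set.Ioo (0 : ℝ) 1, 0 < deriv Real.smoothTransition t := by
  obtain ⟨t, ht, h⟩ := exists_deriv_eq_slope Real.smoothTransition zero_lt_one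
    Real.smoothTransition.continuous.continuousOn
    ((Real.smoothTransition.contDiff (n := 1)).differentiable one_ne_zero).differentiableOn
  refine ⟨t, ht, ?_⟩
  rw [h, Real.smoothTransition.zero, Real.smoothTransition.one]
  norm_num

theorem contDiff_deriv_smoothTransition : ContDiff ℝ 1 (deriv Real.smoothTransition) :=
  ((contDiff_succ_iff_deriv (n := 1)).1 (Real.smoothTransition.contDiff (n := 2))).2.2

/-- The radial weight, as a function of the squared norm. -/
def weight (γ t : ℝ) : ℝ := deriv Real.smoothTransition (2 - t) * t ^ (γ / 2)

theorem weight_of_le_one (γ : ℝ) {t : ℝ} (ht : t ≤ 1) : weight γ t = 0 := by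
  rw [weight, Real.deriv_smoothTransition_of_one_le (by linarith), zero_mul]

theorem weight_of_two_le (γ : ℝ) {t : ℝ} (ht : 2 ≤ t) : weight γ t = 0 := by
  rw [weight, Real.deriv_smoothTransition_of_le_zero (by linarith), zero_mul]

theorem weight_nonneg (γ t : ℝ) : 0 ≤ weight γ t := by
  rcases le_total t 1 with ht | ht
  · rw [weight_of_le_one γ ht]
  · exact mul_nonneg Real.smoothTransition.monotone.deriv_nonneg
      (Real.rpow_nonneg (by linarith) _)

theorem contDiff_weight (γ : ℝ) : ContDiff ℝ 1 (weight γ) := by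
  rw [contDiff_iff_contDiffAt]
  intro t
  rcases eq_or_ne t 0 with rfl | ht
  · refine (contDiffAt_const (c := (0 : ℝ))).congr_of_eventuallyEq ?_
    filter_upwards [gt_mem_nhds (zero_lt_one' ℝ)] with s hs
    exact weight_of_le_one γ hs.le
  · exact (contDiff_deriv_smoothTransition.comp (contDiff_const.sub contDiff_id)).contDiffAt.mul
      (Real.contDiffAt_rpow_const_of_ne ht)

theorem contDiff_weight_mul {n : ℕ} (γ : ℝ) {T : Amb n → ℝ}
    (hT : ∀ y, y ≠ 0 → ContDiffAt ℝ 1 T y) :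
    ContDiff ℝ 1 fun y => weight γ (‖y‖ ^ 2) * T y := by
  rw [contDiff_iff_contDiffAt]
  intro y
  rcases eq_or_ne y 0 with rfl | hy
  · refine (contDiffAt_const (c := (0 : ℝ))).congr_of_eventuallyEq ?_
    filter_upwards [Metric.ball_mem_nhds (0 : Amb n) one_pos] with z hz
    rw [weight_of_le_one, zero_mul]
    rw [mem_ball_zero_iff] at hz
    nlinarith [norm_nonneg z]
  · exact ((contDiff_weight γ).comp (contDiff_norm_sq ℝ)).contDiffAt.mul (hT y hy)

theorem hasCompactSupport_of_eq_zero {n : ℕ} {T : Amb n → ℝ}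
    (hT : ∀ y, 4 ≤ ‖y‖ ^ 2 → T y = 0) : HasCompactSupport T := by
  refine HasCompactSupport.of_support_subset_isCompact (isCompact_closedBall (0 : Amb n) 2)
    fun y hy => ?_
  by_contra h
  rw [mem_closedBall_zero_iff, not_le] at h
  exact hy (hT y (by nlinarith))

theorem hasCompactSupport_weight_mul {n : ℕ} (γ : ℝ) (T : Amb n → ℝ) :
    HasCompactSupport fun y => weight γ (‖y‖ ^ 2) * T y :=
  hasCompactSupport_of_eq_zero fun y hy => by
    rw [weight_of_two_le γ (by linarith), zero_mul]

theorem gradRow_smoothTransition_norm_sq {n : ℕ} (y : Amb n) :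
    gradRow (fun y : Amb n => Real.smoothTransition (2 - ‖y‖ ^ 2)) y =
      (-2 * deriv Real.smoothTransition (2 - ‖y‖ ^ 2)) • y.ofLp := by
  have h1 : HasDerivAt Real.smoothTransition (deriv Real.smoothTransition (2 - ‖y‖ ^ 2))
      (2 - ‖y‖ ^ 2) :=
    ((Real.smoothTransition.contDiff (n := 1)).differentiable one_ne_zero _).hasDerivAt
  have h2 := h1.comp_hasFDerivAt y ((hasStrictFDerivAt_norm_sq y).hasFDerivAt.const_sub 2)
  ext k
  rw [gradRow, HasFDerivAt.fderiv (f := fun y : Amb n => Real.smoothTransition (2 - ‖y‖ ^ 2)) h2]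
  simp [EuclideanSpace.inner_single_right]
  ring

/-- A cut-off version of the homogeneous extension. -/
def cutExt {n : ℕ} (h : Sph n → ℝ) (y : Amb n) : ℝ :=
  Real.smoothTransition (2 * ‖y‖ ^ 2 - 1) * Real.smoothTransition (4 - ‖y‖ ^ 2) * homExt h y

theorem contDiff_cutExt {n : ℕ} {h : Sph n → ℝ} (hh : ContMDiff (𝓡 n) 𝓘(ℝ, ℝ) 2 h) :
    ContDiff ℝ 2 (cutExt h) := by
  have hsq : ContDiff ℝ 2 fun y : Amb n => ‖y‖ ^ 2 := contDiff_norm_sq ℝ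
  rw [contDiff_iff_contDiffAt]
  intro y
  rcases eq_or_ne y 0 with rfl | hy
  · refine (contDiffAt_const (c := (0 : ℝ))).congr_of_eventuallyEq ?_
    filter_upwards [Metric.ball_mem_nhds (0 : Amb n) (half_pos one_pos)] with z hz
    rw [mem_ball_zero_iff] at hz
    rw [cutExt, Real.smoothTransition.zero_of_nonpos (by nlinarith [norm_nonneg z]), zero_mul,
      zero_mul]
  · exact (((Real.smoothTransition.contDiff (n := 2)).comp
      ((contDiff_const.mul hsq).sub contDiff_const)).contDiffAt.mul
      ((Real.smoothTransition.contDiff (n := 2)).comp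
        (contDiff_const.sub hsq)).contDiffAt).mul (contDiffAt_homExt hh hy)

/-- The shell 1 < ‖y‖² < 2 contains all points where `weight` is nonzero, and both cut-off factors
equal 1 for 1 ≤ ‖y‖² ≤ 3. -/
theorem cutExt_eventuallyEq {n : ℕ} (h : Sph n → ℝ) {y : Amb n} (h1 : 1 < ‖y‖ ^ 2)
    (h2 : ‖y‖ ^ 2 < 2) : cutExt h =ᶠ[nhds y] homExt h := by
  have hc : Continuous fun y : Amb n => ‖y‖ ^ 2 := by fun_prop
  filter_upwards [hc.continuousAt.eventually (lt_mem_nhds h1),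
    hc.continuousAt.eventually (gt_mem_nhds h2)] with z hz1 hz2
  rw [cutExt, Real.smoothTransition.one_of_one_le (by linarith),
    Real.smoothTransition.one_of_one_le (by linarith), one_mul, one_mul]

/-! ### The obstruction identity. -/

-- `integral_cofactor_identity` with a radial c: its gradient is a multiple of y, so the equation
-- evaluates both determinants.
open MeasureTheory in
theorem IsSolution.integral_weight_eq_zero {n : ℕ} {p : ℝ} {f h : Sph n → ℝ}
    (hs : IsSolution p f h) {i j : Fin (n + 1)} (hij : i ≠ j) :
    ∫ y : Amb n, weight (1 - n - p) (‖y‖ ^ 2) *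
      (radialExt f y * homExt h y ^ (p - 1) *
        (y i * gradRow (homExt h) y i - y j * gradRow (homExt h) y j)) = 0 := by
  have hc : ContDiff ℝ 1 fun y : Amb n => Real.smoothTransition (2 - ‖y‖ ^ 2) :=
    Real.smoothTransition.contDiff.comp (contDiff_const.sub (contDiff_norm_sq ℝ))
  have h1 := integral_cofactor_identity (contDiff_cutExt hs.contMDiff)
    (hasCompactSupport_of_eq_zero fun y hy => by
      rw [cutExt, Real.smoothTransition.zero_of_nonpos (x := 4 - ‖y‖ ^ 2) (by linarith)]; simp)
    hc (hasCompactSupport_of_eq_zero fun y hy =>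
      Real.smoothTransition.zero_of_nonpos (by linarith)) hij
  have h2 : ∀ y : Amb n,
      gradRow (cutExt h) y i * ((hessMatrix (cutExt h) y).updateRow i
        (gradRow (fun y : Amb n => Real.smoothTransition (2 - ‖y‖ ^ 2)) y)).det -
      gradRow (cutExt h) y j * ((hessMatrix (cutExt h) y).updateRow j
        (gradRow (fun y : Amb n => Real.smoothTransition (2 - ‖y‖ ^ 2)) y)).det =
      -2 * (weight (1 - n - p) (‖y‖ ^ 2) *
      (radialExt f y * homExt h y ^ (p - 1) *
        (y i * gradRow (homExt h) y i - y j * gradRow (homExt h) y j))) := by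
    intro y
    rw [gradRow_smoothTransition_norm_sq, Matrix.det_updateRow_smul, Matrix.det_updateRow_smul]
    by_cases hr : 1 < ‖y‖ ^ 2 ∧ ‖y‖ ^ 2 < 2
    · have heq := cutExt_eventuallyEq h hr.1 hr.2
      have hy : y ≠ 0 := by
        rintro rfl
        rw [norm_zero] at hr
        norm_num at hr
      have hr0 : 0 < ‖y‖ := norm_pos_iff.2 hy
      have hgr : ∀ k, gradRow (cutExt h) y k = gradRow (homExt h) y k := fun k => by
        rw [gradRow, gradRow, heq.fderiv_eq]
      have hhess : hessMatrix (cutExt h) y = hessMatrix (homExt h) y := by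
        ext k l
        rw [hessMatrix, hessMatrix, Matrix.of_apply, Matrix.of_apply, heq.fderiv.fderiv_eq]
      -- The exponent of the weight offsets the degree p − 1 of H^{p-1} and leaves the factor
      -- ‖y‖^{-n} of the determinant.
      have hpow : (‖y‖ ^ 2) ^ ((1 - n - p) / 2) * ‖y‖ ^ (p - 1) = (‖y‖⁻¹) ^ n := by
        rw [← Real.rpow_natCast, ← Real.rpow_mul hr0.le, ← Real.rpow_add hr0, ← Real.rpow_natCast,
          Real.inv_rpow hr0.le, ← Real.rpow_neg hr0.le]
        congr 1
        push_cast
        ring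
      rw [hgr, hgr, hhess, hs.det_updateRow_hessMatrix hy, hs.det_updateRow_hessMatrix hy, weight,
        homExt, Real.mul_rpow hr0.le (by rw [radialExt_of_ne h hy]; exact (hs.pos _).le),
        radialExt_of_ne f hy, radialExt_of_ne h hy, ← hpow]
      ring
    · have hω : deriv Real.smoothTransition (2 - ‖y‖ ^ 2) = 0 := by
        rw [not_and_or, not_lt, not_lt] at hr
        rcases hr with hr | hr
        · exact Real.deriv_smoothTransition_of_one_le (by linarith)
        · exact Real.deriv_smoothTransition_of_le_zero (by linarith)
      rw [weight, hω]
      ring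
  simp_rw [h2] at h1
  rw [integral_const_mul] at h1
  linarith

/-! ### The identity for densities depending on one squared coordinate. -/

/-- The square of the `k`-th coordinate of `y / ‖y‖`. -/
def coordSqRatio {n : ℕ} (k : Fin (n + 1)) (y : Amb n) : ℝ := y k ^ 2 / ‖y‖ ^ 2

theorem radialExt_comp_sq_coord {n : ℕ} (φ : ℝ → ℝ) (k : Fin (n + 1)) {y : Amb n} (hy : y ≠ 0) :
    radialExt (fun x : Sph n => φ ((x : Amb n) k ^ 2)) y = φ (coordSqRatio k y) := by
  rw [radialExt_of_ne _ hy]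
  congr 1
  simp [sphProj, coordSqRatio, mul_pow]
  ring

theorem coordSqRatio_nonneg {n : ℕ} (k : Fin (n + 1)) (y : Amb n) : 0 ≤ coordSqRatio k y := by
  unfold coordSqRatio; positivity

theorem coordSqRatio_add_le_one {n : ℕ} {i j : Fin (n + 1)} (hij : i ≠ j) (y : Amb n) :
    coordSqRatio i y + coordSqRatio j y ≤ 1 := by
  rw [coordSqRatio, coordSqRatio, ← add_div]
  refine div_le_one_of_le₀ ?_ (by positivity)
  rw [EuclideanSpace.real_norm_sq_eq, ← Finset.sum_pair (f := fun k => y k ^ 2) hij]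
  exact Finset.sum_le_sum_of_subset_of_nonneg (Finset.subset_univ _) fun k _ _ => sq_nonneg _

theorem contDiffAt_coordSqRatio {n : ℕ} {m : ℕ∞ω} (k : Fin (n + 1)) {y : Amb n} (hy : y ≠ 0) :
    ContDiffAt ℝ m (coordSqRatio k) y := by
  have h1 : ContDiff ℝ m fun y : Amb n => y k :=
    (EuclideanSpace.proj (𝕜 := ℝ) k).contDiff
  exact (h1.pow 2).contDiffAt.div (contDiff_norm_sq ℝ).contDiffAt
    (pow_ne_zero 2 (norm_ne_zero_iff.2 hy))

theorem fderiv_coordSqRatio {n : ℕ} (k : Fin (n + 1)) {y : Amb n} (hy : y ≠ 0) (v : Amb n) :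
    fderiv ℝ (coordSqRatio k) y v =
      2 * y k * v k / ‖y‖ ^ 2 - 2 * y k ^ 2 * inner ℝ y v / ‖y‖ ^ 4 := by
  have hr : ‖y‖ ≠ 0 := norm_ne_zero_iff.2 hy
  have h1 : HasFDerivAt (fun y : Amb n => y k) (EuclideanSpace.proj (𝕜 := ℝ) k) y :=
    (EuclideanSpace.proj (𝕜 := ℝ) k).hasFDerivAt
  have h2 := (hasDerivAt_inv (pow_ne_zero 2 hr)).comp_hasFDerivAt y
    (hasStrictFDerivAt_norm_sq y).hasFDerivAt
  have h3 := (h1.pow 2).mul h2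
  have h4 : (coordSqRatio k : Amb n → ℝ) =
      (fun y : Amb n => y k) ^ 2 * ((fun t : ℝ => t⁻¹) ∘ fun y : Amb n => ‖y‖ ^ 2) := by
    ext z
    simp [coordSqRatio, div_eq_mul_inv]
  rw [h4, HasFDerivAt.fderiv (f := (fun y : Amb n => y k) ^ 2 *
    ((fun t : ℝ => t⁻¹) ∘ fun y : Amb n => ‖y‖ ^ 2)) h3]
  simp
  field_simp
  ring

/-- The derivative of the density `w(|y|²) φ(s) H^p`. -/
theorem fderiv_weight_mul {n : ℕ} (γ p : ℝ) {φ : ℝ → ℝ} (hφ : Differentiable ℝ φ)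
    (i : Fin (n + 1)) {H : Amb n → ℝ} {y : Amb n} (hy : y ≠ 0) (hH : DifferentiableAt ℝ H y)
    (hpos : 0 < H y) (v : Amb n) :
    fderiv ℝ (fun y => weight γ (‖y‖ ^ 2) * (φ (coordSqRatio i y) * H y ^ p)) y v =
      deriv (weight γ) (‖y‖ ^ 2) * (2 * inner ℝ y v) * (φ (coordSqRatio i y) * H y ^ p) +
        weight γ (‖y‖ ^ 2) * (deriv φ (coordSqRatio i y) * fderiv ℝ (coordSqRatio i) y v * H y ^ p
          + φ (coordSqRatio i y) * (p * H y ^ (p - 1) * fderiv ℝ H y v)) := by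
  have h1 := ((contDiff_weight γ).differentiable one_ne_zero (‖y‖ ^ 2)).hasDerivAt.comp_hasFDerivAt
    y (hasStrictFDerivAt_norm_sq y).hasFDerivAt
  have h2 := (hφ (coordSqRatio i y)).hasDerivAt.comp_hasFDerivAt y
    ((contDiffAt_coordSqRatio (m := 1) i hy).differentiableAt one_ne_zero).hasFDerivAt
  have h3 := hH.hasFDerivAt.rpow_const (p := p) (Or.inl hpos.ne')
  rw [HasFDerivAt.fderiv (f := fun y => weight γ (‖y‖ ^ 2) * (φ (coordSqRatio i y) * H y ^ p))
    (h1.mul (h2.mul h3))]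
  simp
  ring

theorem sum_gradRow_mul {n : ℕ} (g : Amb n → ℝ) (y : Amb n) :
    ∑ k, gradRow g y k * y k = fderiv ℝ g y y := by
  have h1 : ∑ l, y l • EuclideanSpace.single l (1 : ℝ) = y := by
    simpa using (EuclideanSpace.basisFun (Fin (n + 1)) ℝ).sum_repr y
  conv_rhs => rw [← h1, map_sum, h1]
  refine Finset.sum_congr rfl fun k _ => ?_
  rw [map_smul, smul_eq_mul, mul_comm, gradRow]

-- The integrand is the divergence of g (y_i e_i − y_j e_j) − g₂ y minus p times the integrand of
-- `IsSolution.integral_weight_eq_zero`, which cancels the derivatives of H.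
open MeasureTheory in
theorem IsSolution.integral_weight_mul_eq_zero {n : ℕ} {p : ℝ} {φ : ℝ → ℝ} {h : Sph n → ℝ}
    (hφ : ContDiff ℝ 1 φ) {i j : Fin (n + 1)} (hij : i ≠ j)
    (hs : IsSolution p (fun x : Sph n => φ ((x : Amb n) i ^ 2)) h) :
    ∫ y : Amb n, weight (1 - n - p) (‖y‖ ^ 2) * (homExt h y ^ p *
      (2 * coordSqRatio i y * (1 - coordSqRatio i y + coordSqRatio j y) *
          deriv φ (coordSqRatio i y) -
        (n + 1 + p) * (coordSqRatio i y - coordSqRatio j y) * φ (coordSqRatio i y))) = 0 := by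
  set γ : ℝ := 1 - n - p
  set H := homExt h
  have hH2 : ∀ y, y ≠ 0 → ContDiffAt ℝ 2 H y := fun y hy => contDiffAt_homExt hs.contMDiff hy
  have hH1 : ∀ y, y ≠ 0 → ContDiffAt ℝ 1 H y := fun y hy => (hH2 y hy).of_le one_le_two
  have hHd : ∀ y, y ≠ 0 → DifferentiableAt ℝ H y := fun y hy =>
    (hH1 y hy).differentiableAt one_ne_zero
  have hHpos : ∀ y, y ≠ 0 → 0 < H y := fun y hy => homExt_pos hs.pos hy
  have hHp : ∀ (q : ℝ) (y : Amb n), y ≠ 0 → ContDiffAt ℝ 1 (fun y => H y ^ q) y := fun q y hy =>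
    (hH1 y hy).rpow_const_of_ne (hHpos y hy).ne'
  have hφs : ∀ y : Amb n, y ≠ 0 → ContDiffAt ℝ 1 (fun y => φ (coordSqRatio i y)) y := fun y hy =>
    hφ.contDiffAt.comp y (contDiffAt_coordSqRatio i hy)
  have hsq : ∀ y : Amb n, y ≠ 0 →
      ContDiffAt ℝ 1 (fun y => coordSqRatio i y - coordSqRatio j y) y := fun y hy =>
    (contDiffAt_coordSqRatio i hy).sub (contDiffAt_coordSqRatio j hy)
  let g : Amb n → ℝ := fun y => weight γ (‖y‖ ^ 2) * (φ (coordSqRatio i y) * H y ^ p)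
  -- The radial correction makes y_i e_i − y_j e_j tangent to spheres, so the derivative of the
  -- weight drops out.
  let g2 : Amb n → ℝ := fun y => weight γ (‖y‖ ^ 2) * (φ (coordSqRatio i y) * H y ^ p *
    (coordSqRatio i y - coordSqRatio j y))
  let K : Amb n → ℝ := fun y => weight γ (‖y‖ ^ 2) * (φ (coordSqRatio i y) * H y ^ (p - 1) *
    (y i * gradRow H y i - y j * gradRow H y j))
  have hg : ContDiff ℝ 1 g := contDiff_weight_mul γ fun y hy => (hφs y hy).mul (hHp p y hy)
  have hgc : HasCompactSupport g := hasCompactSupport_weight_mul γ _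
  have hg2 : ContDiff ℝ 1 g2 :=
    contDiff_weight_mul γ fun y hy => ((hφs y hy).mul (hHp p y hy)).mul (hsq y hy)
  have hg2c : HasCompactSupport g2 := hasCompactSupport_weight_mul γ _
  have hK : ContDiff ℝ 1 K := by
    refine contDiff_weight_mul γ fun y hy => ((hφs y hy).mul (hHp (p - 1) y hy)).mul ?_
    have hgr : ∀ k, ContDiffAt ℝ 1 (fun y => gradRow H y k) y := fun k =>
      ((hH2 y hy).fderiv_right (m := 1) (by norm_num)).clm_apply contDiffAt_const
    have hco : ∀ k, ContDiffAt ℝ 1 (fun y : Amb n => y k) y := fun k =>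
      (EuclideanSpace.proj (𝕜 := ℝ) k).contDiff.contDiffAt
    exact ((hco i).mul (hgr i)).sub ((hco j).mul (hgr j))
  have hKc : HasCompactSupport K := hasCompactSupport_weight_mul γ _
  have hKint : ∫ y, K y = 0 := by
    rw [← hs.integral_weight_eq_zero hij]
    congr 1
    ext y
    rcases eq_or_ne y 0 with rfl | hy
    · simp [K, weight_of_le_one]
    · simp only [K, radialExt_comp_sq_coord φ i hy]
      rfl
  have hint : ∀ {u : Amb n → ℝ}, ContDiff ℝ 1 u → HasCompactSupport u → ∀ k,
      Integrable fun y : Amb n => gradRow u y k * y k + u y := by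
    intro u hu huc k
    have h1 : Continuous (fderiv ℝ u) := hu.continuous_fderiv one_ne_zero
    have h0 := hu.continuous
    refine Integrable.add ?_ (h0.integrable_of_hasCompactSupport huc)
    simp only [gradRow]
    exact Continuous.integrable_of_hasCompactSupport (by fun_prop)
      ((huc.fderiv_apply ℝ _).mul_right)
  have htotal : ∫ y : Amb n, ((gradRow g y i * y i + g y) - (gradRow g y j * y j + g y) -
      ∑ k, (gradRow g2 y k * y k + g2 y) - p * K y) = 0 := by
    rw [integral_sub, integral_sub, integral_sub, integral_finsetSum, integral_const_mul, hKint]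
    · simp only [integral_gradRow_mul_coord_add hg hgc, integral_gradRow_mul_coord_add hg2 hg2c]
      simp
    · exact fun k _ => hint hg2 hg2c k
    · exact hint hg hgc i
    · exact hint hg hgc j
    · exact (hint hg hgc i).sub (hint hg hgc j)
    · exact integrable_finsetSum _ fun k _ => hint hg2 hg2c k
    · exact ((hint hg hgc i).sub (hint hg hgc j)).sub
        (integrable_finsetSum _ fun k _ => hint hg2 hg2c k)
    · exact (hK.continuous.integrable_of_hasCompactSupport hKc).const_mul p
  rw [← htotal]
  congr 1
  ext y
  rcases eq_or_ne y 0 with rfl | hy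
  · simp [K, g, g2, weight_of_le_one]
  have hr : ‖y‖ ≠ 0 := norm_ne_zero_iff.2 hy
  have hyy : inner ℝ y y = ‖y‖ ^ 2 := real_inner_self_eq_norm_sq y
  have hgk : ∀ v, fderiv ℝ g y v = _ := fun v =>
    fderiv_weight_mul γ p (hφ.differentiable one_ne_zero) i hy (hHd y hy) (hHpos y hy) v
  have hratio : ∀ k, fderiv ℝ (coordSqRatio k) y y = 0 := fun k => by
    rw [fderiv_coordSqRatio k hy, hyy]
    field_simp
    ring
  have hg2k : fderiv ℝ g2 y y = (coordSqRatio i y - coordSqRatio j y) * fderiv ℝ g y y := by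
    have h1 := (hg.differentiable one_ne_zero y).hasFDerivAt.mul
      ((hsq y hy).differentiableAt one_ne_zero).hasFDerivAt
    have h2 : g2 = g * fun y => coordSqRatio i y - coordSqRatio j y := by
      ext z; simp only [g2, g, Pi.mul_apply]; ring
    have h3 : fderiv ℝ (fun y : Amb n => coordSqRatio i y - coordSqRatio j y) y y = 0 := by
      rw [fderiv_fun_sub ((contDiffAt_coordSqRatio (m := 1) i hy).differentiableAt one_ne_zero)
        ((contDiffAt_coordSqRatio (m := 1) j hy).differentiableAt one_ne_zero)]
      simp [hratio]
    rw [h2, h1.fderiv]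
    simp [h3]
  have hself : fderiv ℝ H y y = H y := fderiv_homExt_self hs.contMDiff hy
  have hpw : H y ^ p = H y ^ (p - 1) * H y := by
    rw [← Real.rpow_add_one (hHpos y hy).ne', sub_add_cancel]
  have hgradg : ∀ k, gradRow g y k = fderiv ℝ g y (EuclideanSpace.single k 1) := fun k => rfl
  have hgradH : ∀ k, gradRow H y k = fderiv ℝ H y (EuclideanSpace.single k 1) := fun k => rfl
  rw [Finset.sum_add_distrib, sum_gradRow_mul, hg2k, hgradg, hgradg, hgk, hgk, hgk, hratio, hself,
    fderiv_coordSqRatio i hy, fderiv_coordSqRatio i hy, hyy]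
  simp only [K, g2, g, hgradH, EuclideanSpace.inner_single_right, PiLp.single_apply,
    Finset.sum_const, Finset.card_univ, Fintype.card_fin, nsmul_eq_mul, hij, if_true, if_false]
  rw [hpw]
  generalize fderiv ℝ H y (EuclideanSpace.single i 1) = ai
  generalize fderiv ℝ H y (EuclideanSpace.single j 1) = aj
  generalize H y ^ (p - 1) = Hp
  generalize H y = Hy
  generalize weight γ (‖y‖ ^ 2) = W
  generalize deriv (weight γ) (‖y‖ ^ 2) = W'
  generalize φ (coordSqRatio i y) = a
  generalize deriv φ (coordSqRatio i y) = a'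
  simp only [coordSqRatio]
  simp
  field_simp
  ring

/-! ### Regularity, nonexistence criterion and choice of f. -/

/-- A cut-off equal to 1 on the sphere gives a compactly supported C¹ extension, hence a Lipschitz
bound; on a bounded space this implies every smaller Hölder exponent. -/
theorem memHolder_comp_sq_coord {n : ℕ} {φ : ℝ → ℝ} (hφ : ContDiff ℝ 1 φ) (i : Fin (n + 1))
    {α : ℝ≥0} (hα : α ≤ 1) : MemHolder α fun x : Sph n => φ ((x : Amb n) i ^ 2) := by
  have h1 : ContDiff ℝ 1 fun y : Amb n => Real.smoothTransition (2 - ‖y‖ ^ 2) * φ (y i ^ 2) :=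
    (Real.smoothTransition.contDiff.comp (contDiff_const.sub (contDiff_norm_sq ℝ))).mul
      (hφ.comp ((EuclideanSpace.proj (𝕜 := ℝ) i).contDiff.pow 2))
  obtain ⟨C, hC⟩ := h1.lipschitzWith_of_hasCompactSupport (hasCompactSupport_of_eq_zero
    fun y hy => by rw [Real.smoothTransition.zero_of_nonpos (by linarith), zero_mul]) one_ne_zero
  have h2 : (fun x : Sph n => φ ((x : Amb n) i ^ 2)) =
      (fun y : Amb n => Real.smoothTransition (2 - ‖y‖ ^ 2) * φ (y i ^ 2)) ∘ Subtype.val := by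
    ext x
    simp only [Function.comp_apply, Sph.norm_coe]
    rw [Real.smoothTransition.one_of_one_le (by norm_num), one_mul]
  have h3 : LipschitzWith C fun x : Sph n => φ ((x : Amb n) i ^ 2) := by
    rw [h2]
    simpa using hC.comp (LipschitzWith.subtype_val _)
  have : BoundedSpace (Sph n) := Metric.isBounded_sphere.boundedSpace_val
  exact (holderWith_one.2 h3).memHolder.of_le hα

open MeasureTheory in
theorem not_exists_isSolution_of_deriv_le {n : ℕ} (hn : 1 ≤ n) {p : ℝ} {φ : ℝ → ℝ}
    (hφ : ContDiff ℝ 2 φ)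
    (hle : ∀ s q : ℝ, 0 ≤ s → 0 ≤ q → s + q ≤ 1 →
      2 * s * (1 - s + q) * deriv φ s - (n + 1 + p) * (s - q) * φ s ≤ 0)
    (hlt : deriv φ (1 / 2) < 0) :
    ¬ ∃ h : Sph n → ℝ, IsSolution p (fun x => φ ((x : Amb n) (Fin.last n) ^ 2)) h := by
  rintro ⟨h, hs⟩
  have hij : Fin.last n ≠ 0 := by
    rw [Ne, Fin.ext_iff]
    simp
    lia
  have hzero := hs.integral_weight_mul_eq_zero (hφ.of_le one_le_two) hij
  set T : Amb n → ℝ := fun y => homExt h y ^ p *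
      (2 * coordSqRatio (Fin.last n) y * (1 - coordSqRatio (Fin.last n) y + coordSqRatio 0 y) *
          deriv φ (coordSqRatio (Fin.last n) y) -
        (n + 1 + p) * (coordSqRatio (Fin.last n) y - coordSqRatio 0 y) *
          φ (coordSqRatio (Fin.last n) y)) with hT
  have hTle : ∀ y, y ≠ 0 → T y ≤ 0 := fun y hy =>
    mul_nonpos_of_nonneg_of_nonpos (Real.rpow_nonneg (homExt_pos hs.pos hy).le _)
      (hle _ _ (coordSqRatio_nonneg _ _) (coordSqRatio_nonneg _ _) (coordSqRatio_add_le_one hij y))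
  have hTc : ∀ y, y ≠ 0 → ContDiffAt ℝ 1 T y := by
    intro y hy
    have h1 : ∀ k : Fin (n + 1), ContDiffAt ℝ 1 (coordSqRatio k) y := fun k =>
      contDiffAt_coordSqRatio k hy
    have hd : ContDiff ℝ 1 (deriv φ) := ((contDiff_succ_iff_deriv (n := 1)).1 hφ).2.2
    have h2 : ContDiffAt ℝ 1 (fun y => deriv φ (coordSqRatio (Fin.last n) y)) y :=
      hd.contDiffAt.comp y (h1 _)
    have h3 : ContDiffAt ℝ 1 (fun y => φ (coordSqRatio (Fin.last n) y)) y :=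
      (hφ.of_le one_le_two).contDiffAt.comp y (h1 _)
    have h4 : ContDiffAt ℝ 1 (fun y => homExt h y ^ p) y :=
      ((contDiffAt_homExt hs.contMDiff hy).of_le one_le_two).rpow_const_of_ne
        (homExt_pos hs.pos hy).ne'
    exact h4.mul ((((contDiffAt_const.mul (h1 _)).mul
      ((contDiffAt_const.sub (h1 _)).add (h1 _))).mul h2).sub
      ((contDiffAt_const.mul ((h1 _).sub (h1 _))).mul h3))
  have hnonneg : 0 ≤ fun y : Amb n => -(weight (1 - n - p) (‖y‖ ^ 2) * T y) := by
    intro y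
    rcases eq_or_ne y 0 with rfl | hy
    · simp [weight_of_le_one]
    · exact neg_nonneg.2 (mul_nonpos_of_nonneg_of_nonpos (weight_nonneg _ _) (hTle y hy))
  -- A point with s = q = 1/2, where the bracket reduces to φ'(1/2), and with 2 − ‖y‖² = t, where
  -- the weight is positive.
  obtain ⟨t, ht, htpos⟩ := Real.exists_deriv_smoothTransition_pos
  have ha : 0 < (2 - t) / 2 := by linarith [ht.2]
  set a := √((2 - t) / 2) with hadef
  have ha2 : a ^ 2 = (2 - t) / 2 := Real.sq_sqrt ha.le
  let y : Amb n := EuclideanSpace.single (Fin.last n) a + EuclideanSpace.single 0 a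
  have hy1 : y (Fin.last n) = a := by simp [y, hij]
  have hy0 : y 0 = a := by simp [y, hij.symm]
  have hynorm : ‖y‖ ^ 2 = 2 - t := by
    rw [EuclideanSpace.real_norm_sq_eq, Finset.sum_eq_add_of_mem (Fin.last n) 0 (Finset.mem_univ _)
      (Finset.mem_univ _) hij, hy1, hy0, ha2]
    · ring
    · intro k _ hk
      simp [y, hk.1, hk.2]
  have hyne : y ≠ 0 := by
    intro h0
    rw [h0, norm_zero] at hynorm
    linarith [ht.2]
  have hr1 : coordSqRatio (Fin.last n) y = 1 / 2 := by
    rw [coordSqRatio, hynorm, hy1, ha2]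
    have : 2 - t ≠ 0 := by linarith
    field_simp
  have hr0 : coordSqRatio 0 y = 1 / 2 := by
    rw [coordSqRatio, hynorm, hy0, ha2]
    have : 2 - t ≠ 0 := by linarith
    field_simp
  have hne : -(weight (1 - n - p) (‖y‖ ^ 2) * T y) ≠ 0 := by
    have hw : 0 < weight (1 - n - p) (‖y‖ ^ 2) := by
      rw [weight, hynorm, sub_sub_cancel]
      exact mul_pos htpos (Real.rpow_pos_of_pos (by linarith) _)
    have hTneg : T y < 0 := by
      simp only [hT, hr1, hr0]
      refine mul_neg_of_pos_of_neg (Real.rpow_pos_of_pos (homExt_pos hs.pos hyne) _) ?_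
      linarith
    exact neg_ne_zero.2 (mul_neg_of_pos_of_neg hw hTneg).ne
  have hpos := (contDiff_weight_mul (1 - n - p) hTc).continuous.neg
    |>.integral_pos_of_hasCompactSupport_nonneg_nonzero (μ := volume)
      (hasCompactSupport_weight_mul (1 - n - p) T).neg hnonneg hne
  simp only [Pi.neg_apply, integral_neg] at hpos
  rw [hzero, neg_zero] at hpos
  exact lt_irrefl _ hpos

theorem Sph.sq_coord_le_one {n : ℕ} (x : Sph n) (i : Fin (n + 1)) : (x : Amb n) i ^ 2 ≤ 1 := by
  have h := EuclideanSpace.real_norm_sq_eq (x : Amb n)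
  rw [Sph.norm_coe, one_pow] at h
  refine le_of_le_of_eq ?_ h.symm
  exact Finset.single_le_sum (f := fun k => (x : Amb n) k ^ 2) (fun k _ => sq_nonneg _)
    (Finset.mem_univ i)

theorem Sph.eq_northPole_or_eq_neg {n : ℕ} {x : Sph n}
    (hx : (x : Amb n) (Fin.last n) ^ 2 = 1) : x = northPole n ∨ x = -northPole n := by
  have h := EuclideanSpace.real_norm_sq_eq (x : Amb n)
  rw [Sph.norm_coe, one_pow, ← Finset.add_sum_erase _ _ (Finset.mem_univ (Fin.last n)), hx] at h
  have h0 : ∀ k, k ≠ Fin.last n → (x : Amb n) k = 0 := fun k hk => by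
    have h1 := (Finset.sum_eq_zero_iff_of_nonneg (fun k _ => sq_nonneg ((x : Amb n) k))).1
      (by linarith) k (Finset.mem_erase.2 ⟨hk, Finset.mem_univ k⟩)
    exact pow_eq_zero_iff two_ne_zero |>.1 h1
  rcases eq_or_eq_neg_of_sq_eq_sq ((x : Amb n) (Fin.last n)) 1 (by rw [hx, one_pow]) with h1 | h1
  · left
    ext k
    by_cases hk : k = Fin.last n
    · subst hk; simp [northPole, h1]
    · simp [northPole, h0 k hk, hk]
  · right
    ext k
    by_cases hk : k = Fin.last n
    · subst hk; simp [northPole, h1]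
    · simp [northPole, h0 k hk, hk]

theorem deriv_one_sub_pow (m : ℕ) (s : ℝ) :
    deriv (fun s : ℝ => (1 - s) ^ (m + 1)) s = -((m + 1) * (1 - s) ^ m) := by
  have h := ((hasDerivAt_id s).const_sub 1).pow (m + 1)
  rw [HasDerivAt.deriv (f := fun s : ℝ => (1 - s) ^ (m + 1)) h]
  simp

end

theorem theorem1p1 (n : ℕ) (hn : 1 ≤ n) :
    (∃ f : Sph n → ℝ,
      (∀ α : ℝ≥0, 0 < α → α < 1 → MemHolder α f) ∧ (∀ x, 0 < f x) ∧
        ¬ ∃ h : Sph n → ℝ, IsSolution (-(n : ℝ) - 1) f h) ∧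
    (∀ p : ℝ, p < -(n : ℝ) - 1 →
      ∃ f : Sph n → ℝ,
        (∃ α : ℝ≥0, 0 < α ∧ α < 1 ∧ MemHolder α f) ∧
          (∀ x, x ≠ northPole n → x ≠ -northPole n → 0 < f x) ∧
            ¬ ∃ h : Sph n → ℝ, IsSolution p f h) := by
  refine ⟨?_, fun p hp => ?_⟩
  · have hφ : ContDiff ℝ 2 fun s : ℝ => 2 - s := contDiff_const.sub contDiff_id
    have hd : ∀ s, deriv (fun s : ℝ => 2 - s) s = -1 := fun s => by simp
    refine ⟨fun x => 2 - (x : Amb n) (Fin.last n) ^ 2, fun α _ hα =>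
      memHolder_comp_sq_coord (hφ.of_le one_le_two) (Fin.last n) hα.le, fun x => ?_,
      not_exists_isSolution_of_deriv_le hn hφ (fun s q hs hq hsq => ?_) ?_⟩
    · linarith [Sph.sq_coord_le_one x (Fin.last n)]
    · rw [hd]
      nlinarith [mul_nonneg hs (by linarith : 0 ≤ 1 - s + q)]
    · rw [hd]; norm_num
  -- With c = −(n+1+p) > 0, the only term of the bracket with the wrong sign is c s(1−s)^{m+1}; m ≥
  -- c lets 2(m+1) s(1−s)^{m+1} absorb it.
  · obtain ⟨m, hm⟩ := exists_nat_ge (-(n + 1 + p))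
    have hφ : ContDiff ℝ 2 fun s : ℝ => (1 - s) ^ (m + 1) :=
      (contDiff_const.sub contDiff_id).pow (m + 1)
    refine ⟨fun x => (1 - (x : Amb n) (Fin.last n) ^ 2) ^ (m + 1), ⟨1 / 2,
      by norm_num, by norm_num [div_lt_one], memHolder_comp_sq_coord (hφ.of_le one_le_two) (Fin.last n)
        (by norm_num [div_le_one])⟩,
      fun x hx hx' => ?_, not_exists_isSolution_of_deriv_le hn hφ (fun s q hs hq hsq => ?_) ?_⟩
    · have h1 : (x : Amb n) (Fin.last n) ^ 2 ≠ 1 := fun h =>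
        (Sph.eq_northPole_or_eq_neg h).elim hx hx'
      have h2 := lt_of_le_of_ne (Sph.sq_coord_le_one x (Fin.last n)) h1
      exact pow_pos (by linarith) _
    · rw [deriv_one_sub_pow]
      have hpow : 0 ≤ (1 - s) ^ m := pow_nonneg (by linarith) _
      have hfac : 2 * s * (1 - s + q) * -((m + 1) * (1 - s) ^ m) -
          (n + 1 + p) * (s - q) * (1 - s) ^ (m + 1) =
          -((1 - s) ^ m * (s * (1 - s) * (2 * (m + 1) - -(n + 1 + p)) + 2 * (m + 1) * s * q +
            -(n + 1 + p) * (q * (1 - s)))) := by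
        rw [pow_succ]; ring
      rw [hfac, neg_nonpos]
      have h1 : 0 ≤ 1 - s := by linarith
      have h2 : 0 ≤ 2 * ((m : ℝ) + 1) - -(n + 1 + p) := by
        have : (0 : ℝ) ≤ m := m.cast_nonneg
        linarith
      have h3 : 0 ≤ -(n + 1 + p) := by linarith
      positivity
    · rw [deriv_one_sub_pow]
      have : (0 : ℝ) < (m + 1) * (1 - 1 / 2) ^ m := by positivity
      linarith
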